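/- Let $K\ge 1$, let $d\in\mathbb{R}_{\ge 0}^K$ with $d\neq 0$, and let $\gamma\in(0,\infty)$. Let $\Delta=\{p\in\mathbb{R}^K: p_1\ge p_2\ge\dots\ge p_K\ge 0,\ \sum_k p_k=1\}$. For $n\ge 2$, consider the following $n$-player game $G(n,d,s_\gamma)$ with score function $s_\gamma(x)=x^\gamma$: each player $i$ chooses a strategy $P(i)\in\Delta$; then each player $i$ independently samples a type $t_i\in\{1,\dots,K\}$ from $P(i)$; player $i$ receives $d_{t_i}/s_\gamma(C_{t_i})$, where $C_k$ is the number of players (including $i$) who sampled type $k$; players maximize their expected utility. Let $\mathcal{E}_n\subseteq\Delta^n$ be the set of all (possibly asymmetric) Nash equilibria of this game, i.e. of profiles $P=(P(1),\dots,P(n))$ such that no player $i$ can increase her expected utility by replacing $P(i)$ with another element of $\Delta$. For every $n\ge 2$ the game has a unique symmetric equilibrium, i.e. there is a unique $p_{\mathrm{eq}}(n,d,s_\gamma)\in\Delta$ such that $(p_{\mathrm{eq}},\dots,p_{\mathrm{eq}})\in\mathcal{E}_n$. Moreover, there is a constant $C$, depending only on $K$, $d$ and $\gamma$, such that for every sequence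 $(P^{(n)})_{n\ge 2}$ with $P^{(n)}\in\mathcal{E}_n$, the average strategies $\bar p^{(n)}=\frac1n\sum_{i=1}^n P^{(n)}(i)$ satisfy, for all $n\ge 2$ and all $k\in\{1,\dots,K\}$, $$\bigl|p_{\mathrm{eq}}(n,d,s_\gamma)_k-\bar p^{(n)}_k\bigr|\le C\sqrt{\frac{\log n}{n}}.$$ -/

import Mathlib

namespace CompetitionGame

/-- The strategy space `Δ(π)` for the ranking `π = [1, 2, …, K]`: probability vectors on the `K`
types whose entries are weakly decreasing in the type. -/
def strategies (K : ℕ) : Set (Fin K → ℝ) :=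
  {p | p ∈ stdSimplex ℝ (Fin K) ∧ Antitone p}

/-- The number `C_k` of players whose sampled type is `k`, when player `j` has sampled `t j`. -/
def typeCount {n K : ℕ} (t : Fin n → Fin K) (k : Fin K) : ℕ :=
  (Finset.univ.filter fun j => t j = k).card

/-- Expected utility of player `i` in the game with values `d` and score function `s`, when player
`j` plays `P j`: every player `j` independently samples a type `t j` from `P j`, and player `i` then
receives `d (t i) / s C`, where `C` counts the players (including `i`) who sampled `t i`. -/
noncomputable def utility {n K : ℕ} (d : Fin K → ℝ) (s : ℕ → ℝ)
    (P : Fin n → Fin K → ℝ) (i : Fin n) : ℝ :=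
  ∑ t : Fin n → Fin K, (∏ j, P j (t j)) * (d (t i) / s (typeCount t (t i)))

/-- The set of (possibly asymmetric) Nash equilibria of the `n`-player game: profiles of admissible
strategies from which no player gains by deviating to another admissible strategy. -/
def equilibria (n : ℕ) {K : ℕ} (d : Fin K → ℝ) (s : ℕ → ℝ) : Set (Fin n → Fin K → ℝ) :=
  {P | (∀ i, P i ∈ strategies K) ∧
    ∀ i, ∀ q ∈ strategies K, utility d s (Function.update P i q) i ≤ utility d s P i}

/-- `p` is a symmetric equilibrium: the profile in which everyone plays `p` is an equilibrium. -/
def IsSymmetricEquilibrium (n : ℕ) {K : ℕ} (d : Fin K → ℝ) (s : ℕ → ℝ) (p : Fin K → ℝ) : Prop :=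
  (fun _ : Fin n => p) ∈ equilibria n d s

open Classical in
/-- The symmetric equilibrium strategy of the `n`-player game (the zero vector if there is none). -/
noncomputable def pEq (n : ℕ) {K : ℕ} (d : Fin K → ℝ) (s : ℕ → ℝ) : Fin K → ℝ :=
  if h : ∃ p, IsSymmetricEquilibrium n d s p then h.choose else 0

/-- The score function `s_γ(x) = x ^ γ`. -/
noncomputable def powerScore (γ : ℝ) (x : ℕ) : ℝ := (x : ℝ) ^ γ

/-- The average over the players of their strategies. -/
noncomputable def averageStrategy {n K : ℕ} (P : Fin n → Fin K → ℝ) (k : Fin K) : ℝ :=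
  (1 / (n : ℝ)) * ∑ i, P i k

end CompetitionGame

/-! By independence, a player's utility is linear in her own strategy (`utility_eq_sum_typeValue`),
with coefficients `d k * E[(N + 1) ^ (-γ)]`, where `N` is the sum of the opponents' Bernoulli
choices of `k`. With `μ = 1 + E N`, this negative moment equals `μ ^ (-γ) * (1 + O(1 / μ))`: Jensen
gives the lower bound, a quadratic expansion with a Chernoff tail the upper one
(`bernoulliExp_powerScore_le`).

For a symmetric profile the coefficient of `k` depends only on `p k` and decreases strictly in it. A
maximiser of the separable potential is therefore an equilibrium, and monotonicity makes it unique.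

For an arbitrary equilibrium, optimality of prefixes shows that every type of positive value has
average probability bounded below for large `n` (`exists_linear_lower_bound`). Then `μ` is of order
`n`, and after scaling by `n ^ γ` all players face the same rewards `d k * x ^ (-γ)`, with `x` the
average probability, up to `O(1 / n)`. Summing the best-reply inequalities over players puts the
average strategy in an approximate variational inequality. The symmetric equilibrium satisfies one
too; testing each against the other, strong monotonicity of `-x ^ (-γ)` on `(0, 1]` bounds the
squared distance by `O(1 / n)`. Types of value zero tie with their successor in every equilibrium,
so they inherit the bound. The resulting rate `1 / √n` is stronger than the one required. -/

namespace CompetitionGame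

/-! ### Expectations over sums of independent Bernoulli variables -/

open Polynomial

/-- The linear functional on polynomials sending `X ^ m` to `φ m`. -/
noncomputable def weightedSum (φ : ℕ → ℝ) : ℝ[X] →ₗ[ℝ] ℝ :=
  Polynomial.lsum fun m => φ m • LinearMap.id

lemma weightedSum_monomial (φ : ℕ → ℝ) (m : ℕ) (a : ℝ) :
    weightedSum φ (monomial m a) = φ m * a := by
  simp [weightedSum, Polynomial.lsum_apply, Polynomial.sum_monomial_index]

lemma weightedSum_X_mul (φ : ℕ → ℝ) (Q : ℝ[X]) :
    weightedSum φ (X * Q) = weightedSum (fun m => φ (m + 1)) Q := by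
  induction Q using Polynomial.induction_on' with
  | add p q hp hq => rw [mul_add, map_add, map_add, hp, hq]
  | monomial m a =>
    rw [X_mul_monomial, weightedSum_monomial, weightedSum_monomial]

/-- The expectation of `φ N` where `N` is a sum of independent Bernoulli variables with
parameters `p j`, `j ∈ S`. -/
noncomputable def bernoulliExp {ι : Type*} (S : Finset ι) (p : ι → ℝ) (φ : ℕ → ℝ) : ℝ :=
  weightedSum φ (∏ j ∈ S, (C (1 - p j) + C (p j) * X))

section bernoulliExp

variable {ι : Type*} (p : ι → ℝ)

@[simp] lemma bernoulliExp_empty (φ : ℕ → ℝ) : bernoulliExp ∅ p φ = φ 0 := by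
  have := weightedSum_monomial φ 0 1
  simpa [bernoulliExp] using this

/-- Conditioning on the variable `j`. The moment formulas and comparisons below are inductions on
this recursion. -/
lemma bernoulliExp_insert [DecidableEq ι] {S : Finset ι} {j : ι} (hj : j ∉ S) (φ : ℕ → ℝ) :
    bernoulliExp (insert j S) p φ =
      (1 - p j) * bernoulliExp S p φ + p j * bernoulliExp S p (fun m => φ (m + 1)) := by
  rw [bernoulliExp, Finset.prod_insert hj, add_mul, mul_assoc, map_add, ← smul_eq_C_mul,
    ← smul_eq_C_mul, map_smul, map_smul, weightedSum_X_mul]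
  rfl

lemma bernoulliExp_add (S : Finset ι) (φ ψ : ℕ → ℝ) :
    bernoulliExp S p (fun m => φ m + ψ m) = bernoulliExp S p φ + bernoulliExp S p ψ := by
  classical
  induction S using Finset.induction_on generalizing φ ψ with
  | empty => simp
  | insert j S hj ih => simp only [bernoulliExp_insert p hj, ih]; ring

lemma bernoulliExp_const_mul (S : Finset ι) (a : ℝ) (φ : ℕ → ℝ) :
    bernoulliExp S p (fun m => a * φ m) = a * bernoulliExp S p φ := by
  classical
  induction S using Finset.induction_on generalizing φ with
  | empty => simp
  | insert j S hj ih => simp only [bernoulliExp_insert p hj, ih]; ring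

lemma bernoulliExp_const (S : Finset ι) (a : ℝ) : bernoulliExp S p (fun _ => a) = a := by
  classical
  induction S using Finset.induction_on with
  | empty => simp
  | insert j S hj ih => simp only [bernoulliExp_insert p hj, ih]; ring

lemma bernoulliExp_id (S : Finset ι) :
    bernoulliExp S p (fun m => (m : ℝ)) = ∑ j ∈ S, p j := by
  classical
  induction S using Finset.induction_on with
  | empty => simp
  | insert j S hj ih =>
    simp only [bernoulliExp_insert p hj, Nat.cast_add, Nat.cast_one, bernoulliExp_add, ih,
      bernoulliExp_const, Finset.sum_insert hj]
    ring

lemma bernoulliExp_sq (S : Finset ι) :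
    bernoulliExp S p (fun m => (m : ℝ) ^ 2) =
      (∑ j ∈ S, p j) ^ 2 + ∑ j ∈ S, p j * (1 - p j) := by
  classical
  induction S using Finset.induction_on with
  | empty => simp
  | insert j S hj ih =>
    have h : (fun m : ℕ => ((m + 1 : ℕ) : ℝ) ^ 2) = fun m : ℕ => (m : ℝ) ^ 2 + (2 * (m : ℝ) + 1) := by
      funext m; push_cast; ring
    rw [bernoulliExp_insert p hj, h]
    simp only [bernoulliExp_add, bernoulliExp_const_mul, bernoulliExp_id, ih,
      bernoulliExp_const, Finset.sum_insert hj]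
    ring

lemma bernoulliExp_pow (S : Finset ι) (z : ℝ) :
    bernoulliExp S p (fun m => z ^ m) = ∏ j ∈ S, (1 - p j * (1 - z)) := by
  classical
  induction S using Finset.induction_on with
  | empty => simp
  | insert j S hj ih =>
    simp only [bernoulliExp_insert p hj, pow_succ', bernoulliExp_const_mul, ih,
      Finset.prod_insert hj]
    ring

variable {p}

lemma bernoulliExp_mono {S : Finset ι} (hp : ∀ j ∈ S, p j ∈ Set.Icc (0 : ℝ) 1) {φ ψ : ℕ → ℝ}
    (h : ∀ m, φ m ≤ ψ m) : bernoulliExp S p φ ≤ bernoulliExp S p ψ := by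
  classical
  induction S using Finset.induction_on generalizing φ ψ with
  | empty => simpa using h 0
  | insert j S hj ih =>
    have hS : ∀ j ∈ S, p j ∈ Set.Icc (0 : ℝ) 1 := fun l hl => hp l (Finset.mem_insert_of_mem hl)
    obtain ⟨h0, h1⟩ := hp j (Finset.mem_insert_self j S)
    rw [bernoulliExp_insert p hj, bernoulliExp_insert p hj]
    exact add_le_add (mul_le_mul_of_nonneg_left (ih hS h) (by linarith))
      (mul_le_mul_of_nonneg_left (ih hS fun m => h (m + 1)) h0)

lemma bernoulliExp_strictMono {S : Finset ι} (hp : ∀ j ∈ S, p j ∈ Set.Icc (0 : ℝ) 1)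
    {φ ψ : ℕ → ℝ} (h : ∀ m, φ m < ψ m) : bernoulliExp S p φ < bernoulliExp S p ψ := by
  classical
  induction S using Finset.induction_on generalizing φ ψ with
  | empty => simpa using h 0
  | insert j S hj ih =>
    have hS : ∀ j ∈ S, p j ∈ Set.Icc (0 : ℝ) 1 := fun l hl => hp l (Finset.mem_insert_of_mem hl)
    obtain ⟨h0, h1⟩ := hp j (Finset.mem_insert_self j S)
    rw [bernoulliExp_insert p hj, bernoulliExp_insert p hj]
    have a := ih hS h
    have b := ih hS fun m => h (m + 1)
    rcases h0.lt_or_eq with h0 | h0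
    · exact add_lt_add_of_le_of_lt (mul_le_mul_of_nonneg_left a.le (by linarith))
        (mul_lt_mul_of_pos_left b h0)
    · rw [← h0]; linarith

/-- Stochastic monotonicity: raising one parameter shifts weight from `φ m` to the smaller `φ (m +
1)`. -/
lemma bernoulliExp_anti_param {S : Finset ι} {q : ι → ℝ} (hp : ∀ j ∈ S, p j ∈ Set.Icc (0 : ℝ) 1)
    (hq : ∀ j ∈ S, q j ∈ Set.Icc (0 : ℝ) 1) (hpq : ∀ j ∈ S, p j ≤ q j) {φ : ℕ → ℝ}
    (h : Antitone φ) : bernoulliExp S q φ ≤ bernoulliExp S p φ := by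
  classical
  induction S using Finset.induction_on generalizing φ with
  | empty => simp
  | insert j S hj ih =>
    simp only [Finset.forall_mem_insert] at hp hq hpq
    rw [bernoulliExp_insert p hj, bernoulliExp_insert q hj]
    have a := ih hp.2 hq.2 hpq.2 h
    have b := ih hp.2 hq.2 hpq.2 (φ := fun m => φ (m + 1)) fun x y hxy => h (by omega)
    have c := bernoulliExp_mono hq.2 (φ := fun m => φ (m + 1)) (ψ := φ) fun m => h (by omega)
    have a' := mul_le_mul_of_nonneg_left a (sub_nonneg.2 hp.1.2)
    have b' := mul_le_mul_of_nonneg_left b hp.1.1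
    have c' := mul_le_mul_of_nonneg_left c (sub_nonneg.2 hpq.1)
    linarith

lemma bernoulliExp_strictAnti_param {S : Finset ι} (hS : S.Nonempty) {q : ι → ℝ}
    (hp : ∀ j ∈ S, p j ∈ Set.Icc (0 : ℝ) 1)
    (hq : ∀ j ∈ S, q j ∈ Set.Icc (0 : ℝ) 1) (hpq : ∀ j ∈ S, p j < q j) {φ : ℕ → ℝ}
    (h : StrictAnti φ) : bernoulliExp S q φ < bernoulliExp S p φ := by
  classical
  obtain ⟨j, hjS⟩ := hS
  rw [← Finset.insert_erase hjS] at hp hq hpq ⊢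
  have hj := Finset.notMem_erase j S
  simp only [Finset.forall_mem_insert] at hp hq hpq
  rw [bernoulliExp_insert p hj, bernoulliExp_insert q hj]
  have hle := fun l hl => (hpq.2 l hl).le
  have a := bernoulliExp_anti_param hp.2 hq.2 hle h.antitone
  have b := bernoulliExp_anti_param hp.2 hq.2 hle (φ := fun m => φ (m + 1))
    fun x y hxy => h.antitone (by omega)
  have c := bernoulliExp_strictMono hq.2 (φ := fun m => φ (m + 1)) (ψ := φ) fun m => h (by omega)
  have a' := mul_le_mul_of_nonneg_left a (sub_nonneg.2 hp.1.2)
  have b' := mul_le_mul_of_nonneg_left b hp.1.1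
  have c' := mul_lt_mul_of_pos_left c (sub_pos.2 hpq.1)
  linarith

lemma continuous_bernoulliExp_param (S : Finset ι) (φ : ℕ → ℝ) :
    Continuous fun x : ℝ => bernoulliExp S (fun _ => x) φ := by
  classical
  induction S using Finset.induction_on generalizing φ with
  | empty => simpa using continuous_const
  | insert j S hj ih =>
    simp only [bernoulliExp_insert _ hj]
    have := ih φ
    have := ih fun m => φ (m + 1)
    fun_prop

lemma bernoulliExp_congr {S : Finset ι} {q : ι → ℝ} (h : ∀ j ∈ S, p j = q j) (φ : ℕ → ℝ) :
    bernoulliExp S p φ = bernoulliExp S q φ := by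
  unfold bernoulliExp
  rw [Finset.prod_congr rfl fun j hj => by rw [h j hj]]

end bernoulliExp

/-! ### Linearity of the utility in the player's own strategy -/

section utility

variable {n K : ℕ}

/-- The expected reward per unit of probability that player `i` puts on type `k`. -/
noncomputable def typeValue (d : Fin K → ℝ) (s : ℕ → ℝ) (P : Fin n → Fin K → ℝ) (i : Fin n)
    (k : Fin K) : ℝ :=
  d k * bernoulliExp (Finset.univ.erase i) (fun j => P j k) (fun m => 1 / s (m + 1))

lemma weightedSum_X_pow (φ : ℕ → ℝ) (m : ℕ) : weightedSum φ (X ^ m) = φ m := by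
  simpa [monomial_one_right_eq_X_pow] using weightedSum_monomial φ m 1

lemma prod_ite_X_eq_X_pow_typeCount (t : Fin n → Fin K) (k : Fin K) :
    ∏ j, (if t j = k then (X : ℝ[X]) else 1) = X ^ typeCount t k := by
  rw [Finset.prod_ite, Finset.prod_const, Finset.prod_const_one, mul_one, typeCount]

/-- Once player `i` has drawn `k`, only the count of `k` matters, and its generating polynomial
factors over the players. The factor `X` of player `i` herself is the `+ 1` in `typeValue`. -/
lemma utility_eq_sum_typeValue (d : Fin K → ℝ) (s : ℕ → ℝ) (P : Fin n → Fin K → ℝ) (i : Fin n)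
    (hP : ∀ j, j ≠ i → ∑ l, P j l = 1) :
    utility d s P i = ∑ k, P i k * typeValue d s P i k := by
  -- `X` marks the players of type `k`, and the last factor is the indicator of `t i = k`, written
  -- as a product over players so that sum and product can be exchanged.
  have key : ∀ k, ∑ t : Fin n → Fin K, ∏ j, (C (P j (t j)) * (if t j = k then (X : ℝ[X]) else 1) *
      (if j = i then (if t j = k then 1 else 0) else 1)) =
      C (P i k) * (X * ∏ j ∈ Finset.univ.erase i, (C (1 - P j k) + C (P j k) * X)) := by
    intro k
    rw [← Fintype.prod_sum (fun j l => C (P j l) * (if l = k then (X : ℝ[X]) else 1) *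
      (if j = i then (if l = k then 1 else 0) else 1)),
      ← Finset.mul_prod_erase _ _ (Finset.mem_univ i), ← mul_assoc]
    congr 1
    · simp
    · refine Finset.prod_congr rfl fun j hj => ?_
      have hji := Finset.ne_of_mem_erase hj
      have h1 := hP j hji
      rw [← Finset.add_sum_erase _ _ (Finset.mem_univ k)] at h1 ⊢
      have h2 : ∑ x ∈ Finset.univ.erase k, C (P j x) * (if x = k then (X : ℝ[X]) else 1) *
          (if j = i then (if x = k then 1 else 0) else 1) = C (1 - P j k) := by
        rw [← h1, add_sub_cancel_left, map_sum]
        refine Finset.sum_congr rfl fun x hx => ?_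
        simp [Finset.ne_of_mem_erase hx, hji]
      rw [h2]
      simp [hji, add_comm]
  have hk : ∀ k, P i k * typeValue d s P i k = ∑ t : Fin n → Fin K,
      if t i = k then (∏ j, P j (t j)) * (d (t i) / s (typeCount t (t i))) else 0 := by
    intro k
    have h := congrArg (weightedSum fun m => 1 / s m) (key k)
    rw [← smul_eq_C_mul, map_smul, weightedSum_X_mul, map_sum] at h
    change _ = P i k * bernoulliExp _ _ _ at h
    rw [typeValue, mul_left_comm, ← h, Finset.mul_sum]
    refine Finset.sum_congr rfl fun t _ => ?_
    rw [Finset.prod_mul_distrib, Finset.prod_mul_distrib, prod_ite_X_eq_X_pow_typeCount,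
      Finset.prod_ite_eq' Finset.univ i, if_pos (Finset.mem_univ i), ← map_prod]
    split_ifs with htk
    · subst htk
      rw [mul_one, ← smul_eq_C_mul, map_smul, weightedSum_X_pow, smul_eq_mul]
      ring
    · simp
  simp_rw [hk]
  rw [Finset.sum_comm, utility]
  simp

end utility

/-! ### Negative moments of one plus a Bernoulli sum -/

lemma one_sub_mul_le_rpow_neg {a y : ℝ} (ha : 0 ≤ a) (hy : 0 < y) :
    1 - a * (y - 1) ≤ y ^ (-a) := by
  rw [Real.rpow_def_of_pos hy]
  have h1 := Real.add_one_le_exp (Real.log y * -a)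
  have h2 := mul_le_mul_of_nonneg_left (Real.log_le_sub_one_of_pos hy) ha
  linarith

/-- Convexity again: the tangent at `y` lies below the graph at `1`. -/
lemma rpow_neg_le_one_add {a y : ℝ} (ha : 0 ≤ a) (hy : 0 < y) :
    y ^ (-a) ≤ 1 + a * y ^ (-a - 1) * (1 - y) := by
  have h := one_sub_mul_le_rpow_neg ha (inv_pos.2 hy)
  rw [Real.inv_rpow hy.le, Real.rpow_neg hy.le, inv_inv] at h
  have hpos : 0 < y ^ (-a) := Real.rpow_pos_of_pos hy _
  have h' := mul_le_mul_of_nonneg_left h hpos.le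
  rw [← Real.rpow_add hy, neg_add_cancel, Real.rpow_zero] at h'
  rw [Real.rpow_sub_one hy.ne']
  have : y ^ (-a) * (1 - a * (y⁻¹ - 1)) = y ^ (-a) - a * (y ^ (-a) / y) * (1 - y) := by
    field_simp
  linarith

/-- The constant in the quadratic upper bound for `y ^ (-γ)` around `1`. -/
noncomputable def quadConst (γ : ℝ) : ℝ := γ * ((γ + 1) * 2 ^ (γ + 2))

/-- The tangent bounds are applied twice, the second time to the slope `y ^ (-γ - 1)`; staying above
`1 / 2` keeps the next slope `y ^ (-γ - 2)` bounded. -/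
lemma rpow_neg_le_quadratic {γ y : ℝ} (hγ : 0 < γ) (hy : 1 / 2 ≤ y) :
    y ^ (-γ) ≤ 1 - γ * (y - 1) + quadConst γ * (y - 1) ^ 2 := by
  have hy0 : 0 < y := by linarith
  have h1 := rpow_neg_le_one_add hγ.le hy0
  have hone : (1 : ℝ) ≤ 2 ^ (γ + 2) := Real.one_le_rpow (by norm_num) (by linarith)
  have key : (1 - y) * (y ^ (-γ - 1) - 1) ≤ (γ + 1) * 2 ^ (γ + 2) * (y - 1) ^ 2 := by
    have e : -γ - 1 = -(γ + 1) := by ring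
    rcases le_total y 1 with h | h
    · have h2 := rpow_neg_le_one_add (a := γ + 1) (by linarith) hy0
      have h3 : y ^ (-(γ + 1) - 1) ≤ 2 ^ (γ + 2) := by
        calc y ^ (-(γ + 1) - 1) ≤ (1 / 2 : ℝ) ^ (-(γ + 1) - 1) :=
              Real.rpow_le_rpow_of_nonpos (by norm_num) hy (by linarith)
          _ = 2 ^ (γ + 2) := by
              rw [one_div, Real.inv_rpow (by norm_num), ← Real.rpow_neg (by norm_num)]
              congr 1; ring
      have h4 : y ^ (-γ - 1) - 1 ≤ (γ + 1) * 2 ^ (γ + 2) * (1 - y) := by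
        have := mul_le_mul_of_nonneg_right
          (mul_le_mul_of_nonneg_left h3 (by linarith : (0 : ℝ) ≤ γ + 1)) (sub_nonneg.2 h)
        rw [e]; linarith
      have := mul_le_mul_of_nonneg_left h4 (sub_nonneg.2 h)
      linarith
    · have h2 := one_sub_mul_le_rpow_neg (a := γ + 1) (by linarith) hy0
      rw [← e] at h2
      have h3 : 1 - y ^ (-γ - 1) ≤ (γ + 1) * (y - 1) := by linarith
      have h4 := mul_le_mul_of_nonneg_left h3 (sub_nonneg.2 h)
      have h5 := mul_le_mul_of_nonneg_left hone
        (by positivity : 0 ≤ (γ + 1) * (y - 1) ^ 2)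
      linarith
  have := mul_le_mul_of_nonneg_left key hγ.le
  unfold quadConst
  linarith

lemma rpow_le_const_mul_exp {a t : ℝ} (ha : 0 < a) (ht : 0 < t) :
    t ^ a ≤ (10 * a) ^ a * Real.exp (t / 10) := by
  have hx : 0 < t / (10 * a) := by positivity
  have h1 : (t / (10 * a)) ^ a ≤ Real.exp (t / 10) := by
    rw [Real.rpow_def_of_pos hx, Real.exp_le_exp]
    have := mul_le_mul_of_nonneg_right (Real.log_le_sub_one_of_pos hx) ha.le
    have e : t / (10 * a) * a = t / 10 := by field_simp
    linarith
  rw [Real.div_rpow ht.le (by positivity), div_le_iff₀ (by positivity)] at h1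
  linarith

section moments

variable {ι : Type*} {p : ι → ℝ}

/-- The mean of one plus a sum of independent Bernoulli variables. -/
def shiftedMean (S : Finset ι) (p : ι → ℝ) : ℝ := 1 + ∑ j ∈ S, p j

lemma one_le_shiftedMean {S : Finset ι} (hp : ∀ j ∈ S, p j ∈ Set.Icc (0 : ℝ) 1) :
    1 ≤ shiftedMean S p := by
  have := Finset.sum_nonneg fun j hj => (hp j hj).1
  unfold shiftedMean; linarith

/-- Jensen's inequality, via the tangent to `x ^ (-γ)` at the mean. -/
lemma rpow_neg_shiftedMean_le {γ : ℝ} (hγ : 0 < γ) {S : Finset ι}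
    (hp : ∀ j ∈ S, p j ∈ Set.Icc (0 : ℝ) 1) :
    shiftedMean S p ^ (-γ) ≤ bernoulliExp S p fun m => 1 / powerScore γ (m + 1) := by
  have hμ := one_le_shiftedMean hp
  set μ := shiftedMean S p with hμ_def
  have hμ0 : 0 < μ := by linarith
  have hpos : 0 < μ ^ (-γ) := Real.rpow_pos_of_pos hμ0 _
  have hpt : ∀ m : ℕ, μ ^ (-γ) * (1 + γ - γ / μ) + -(μ ^ (-γ) * γ / μ) * (m : ℝ) ≤
      1 / powerScore γ (m + 1) := by
    intro m
    have hm : (0 : ℝ) < (m : ℝ) + 1 := by positivity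
    have h := mul_le_mul_of_nonneg_left
      (one_sub_mul_le_rpow_neg hγ.le (div_pos hm hμ0)) hpos.le
    rw [← Real.mul_rpow hμ0.le (by positivity), mul_div_cancel₀ _ hμ0.ne'] at h
    rw [powerScore, Nat.cast_add, Nat.cast_one, one_div, ← Real.rpow_neg hm.le]
    refine le_trans (le_of_eq ?_) h
    field_simp
    ring
  refine le_trans (le_of_eq ?_) (bernoulliExp_mono hp hpt)
  rw [bernoulliExp_add, bernoulliExp_const, bernoulliExp_const_mul, bernoulliExp_id]
  have : ∑ j ∈ S, p j = μ - 1 := by rw [hμ_def, shiftedMean]; ring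
  rw [this]
  field_simp
  ring

/-- The constant in the upper bound for the negative moment of order `γ`. -/
noncomputable def momentConst (γ : ℝ) : ℝ := quadConst γ + (10 * (γ + 1)) ^ (γ + 1)

lemma momentConst_nonneg {γ : ℝ} (hγ : 0 < γ) : 0 ≤ momentConst γ := by
  unfold momentConst quadConst; positivity

/-- A Chernoff bound: the integrand dominates the indicator of `m + 1 ≤ μ / 2`. Since `1 - exp (-1)
≥ 3 / 5`, the exponent is at most `μ / 2 - 1 - 3 / 5 * (μ - 1)`. -/
lemma bernoulliExp_exp_neg_le {S : Finset ι} (hp : ∀ j ∈ S, p j ∈ Set.Icc (0 : ℝ) 1) :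
    bernoulliExp S p (fun m => Real.exp (shiftedMean S p / 2 - (m + 1))) ≤
      Real.exp (-(shiftedMean S p / 10)) := by
  set μ := shiftedMean S p with hμ_def
  have e : (fun m : ℕ => Real.exp (μ / 2 - (m + 1))) =
      fun m : ℕ => Real.exp (μ / 2 - 1) * Real.exp (-1) ^ m := by
    funext m
    rw [← Real.exp_nat_mul, ← Real.exp_add]
    congr 1; ring
  have hz : Real.exp (-1) ≤ 2 / 5 := by
    rw [Real.exp_neg, inv_le_comm₀ (Real.exp_pos _) (by norm_num)]
    have := Real.exp_one_gt_d9
    norm_num; linarith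
  rw [e, bernoulliExp_const_mul, bernoulliExp_pow]
  have hprod : ∏ j ∈ S, (1 - p j * (1 - Real.exp (-1))) ≤ Real.exp (-(3 / 5 * (μ - 1))) := by
    have hs : -(3 / 5 * (μ - 1)) = ∑ j ∈ S, -(3 / 5 * p j) := by
      rw [Finset.sum_neg_distrib, ← Finset.mul_sum, hμ_def, shiftedMean]; ring
    rw [hs, Real.exp_sum]
    refine Finset.prod_le_prod (fun j hj => ?_) fun j hj => ?_
    · have := Real.exp_pos (-1)
      have := mul_nonneg (hp j hj).1 this.le
      linarith [(hp j hj).2]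
    · have h1 := Real.add_one_le_exp (-(3 / 5 * p j))
      have := mul_le_mul_of_nonneg_left hz (hp j hj).1
      linarith
  refine (mul_le_mul_of_nonneg_left hprod (Real.exp_pos _).le).trans ?_
  rw [← Real.exp_add, Real.exp_le_exp]
  have := one_le_shiftedMean hp
  linarith

/-- In the quadratic bound at the mean the linear term cancels, and variance at most `μ` makes the
relative error `quadConst γ / μ`; the lower tail is exponentially small. -/
lemma bernoulliExp_powerScore_le {γ : ℝ} (hγ : 0 < γ) {S : Finset ι}
    (hp : ∀ j ∈ S, p j ∈ Set.Icc (0 : ℝ) 1) :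
    (bernoulliExp S p fun m => 1 / powerScore γ (m + 1)) ≤
      shiftedMean S p ^ (-γ) * (1 + momentConst γ / shiftedMean S p) := by
  have hμ := one_le_shiftedMean hp
  have htail := bernoulliExp_exp_neg_le hp
  set μ := shiftedMean S p with hμ_def
  have hμ0 : 0 < μ := by linarith
  have hpos : 0 < μ ^ (-γ) := Real.rpow_pos_of_pos hμ0 _
  have hQ : 0 ≤ quadConst γ := by unfold quadConst; positivity
  have hpt : ∀ m : ℕ, 1 / powerScore γ (m + 1) ≤
      μ ^ (-γ) * ((1 + γ - γ / μ + quadConst γ * (1 / μ - 1) ^ 2) +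
        ((-(γ / μ) + 2 * quadConst γ * (1 / μ - 1) / μ) * (m : ℝ) +
          quadConst γ / μ ^ 2 * (m : ℝ) ^ 2)) + Real.exp (μ / 2 - (m + 1)) := by
    intro m
    have hm : (0 : ℝ) < (m : ℝ) + 1 := by positivity
    rw [powerScore, Nat.cast_add, Nat.cast_one, one_div, ← Real.rpow_neg hm.le]
    have e : μ ^ (-γ) * ((1 + γ - γ / μ + quadConst γ * (1 / μ - 1) ^ 2) +
        ((-(γ / μ) + 2 * quadConst γ * (1 / μ - 1) / μ) * (m : ℝ) +
          quadConst γ / μ ^ 2 * (m : ℝ) ^ 2)) = μ ^ (-γ) * (1 - γ * ((m + 1) / μ - 1) +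
            quadConst γ * ((m + 1) / μ - 1) ^ 2) := by
      field_simp; ring
    rw [e]
    -- Above half the mean the quadratic bound applies; below it the exponential already exceeds
    -- `1`.
    rcases le_total (1 / 2) (((m : ℝ) + 1) / μ) with h | h
    · have h1 := mul_le_mul_of_nonneg_left (rpow_neg_le_quadratic hγ h) hpos.le
      rw [← Real.mul_rpow hμ0.le (by positivity), mul_div_cancel₀ _ hμ0.ne'] at h1
      have := Real.exp_pos (μ / 2 - (m + 1))
      linarith
    · have h1 : ((m : ℝ) + 1) ^ (-γ) ≤ 1 :=
        Real.rpow_le_one_of_one_le_of_nonpos (by linarith [Nat.cast_nonneg (α := ℝ) m])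
          (by linarith)
      have h2 : 1 ≤ Real.exp (μ / 2 - (m + 1)) := by
        rw [Real.one_le_exp_iff]
        rw [div_le_iff₀ hμ0] at h
        linarith
      have h3 : 0 ≤ μ ^ (-γ) * (1 - γ * ((m + 1) / μ - 1) +
            quadConst γ * ((m + 1) / μ - 1) ^ 2) := by
        refine mul_nonneg hpos.le (add_nonneg ?_ (by positivity))
        have := mul_nonneg hγ.le (by linarith : 0 ≤ 1 - ((m : ℝ) + 1) / μ)
        linarith
      linarith
  refine (bernoulliExp_mono hp hpt).trans ?_
  simp only [bernoulliExp_add, bernoulliExp_const_mul, bernoulliExp_const, bernoulliExp_id,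
    bernoulliExp_sq]
  have hs : ∑ j ∈ S, p j = μ - 1 := by rw [hμ_def, shiftedMean]; ring
  have hv : ∑ j ∈ S, p j * (1 - p j) ≤ μ := by
    calc ∑ j ∈ S, p j * (1 - p j) ≤ ∑ j ∈ S, p j :=
          Finset.sum_le_sum fun j hj => by nlinarith [(hp j hj).1, (hp j hj).2]
      _ ≤ μ := by linarith
  have htail2 : Real.exp (-(μ / 10)) ≤ μ ^ (-γ) * ((10 * (γ + 1)) ^ (γ + 1) / μ) := by
    have h := rpow_le_const_mul_exp (a := γ + 1) (by linarith) hμ0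
    rw [Real.exp_neg, inv_le_iff_one_le_mul₀ (Real.exp_pos _), Real.rpow_neg hμ0.le]
    rw [Real.rpow_add_one hμ0.ne'] at h
    have h0 : 0 < μ ^ γ := Real.rpow_pos_of_pos hμ0 _
    rw [show (μ ^ γ)⁻¹ * ((10 * (γ + 1)) ^ (γ + 1) / μ) * Real.exp (μ / 10) =
      ((10 * (γ + 1)) ^ (γ + 1) * Real.exp (μ / 10)) / (μ ^ γ * μ) by field_simp,
      one_le_div (by positivity)]
    exact h
  have hmain : μ ^ (-γ) * ((1 + γ - γ / μ + quadConst γ * (1 / μ - 1) ^ 2) +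
        ((-(γ / μ) + 2 * quadConst γ * (1 / μ - 1) / μ) * (μ - 1) +
          quadConst γ / μ ^ 2 * ((μ - 1) ^ 2 + ∑ j ∈ S, p j * (1 - p j)))) ≤
      μ ^ (-γ) * (1 + quadConst γ / μ) := by
    refine mul_le_mul_of_nonneg_left ?_ hpos.le
    have e : (1 + γ - γ / μ + quadConst γ * (1 / μ - 1) ^ 2) +
        ((-(γ / μ) + 2 * quadConst γ * (1 / μ - 1) / μ) * (μ - 1) +
          quadConst γ / μ ^ 2 * ((μ - 1) ^ 2 + ∑ j ∈ S, p j * (1 - p j))) =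
        1 + quadConst γ / μ ^ 2 * ∑ j ∈ S, p j * (1 - p j) := by
      field_simp; ring
    rw [e]
    have h1 := mul_le_mul_of_nonneg_left hv (by positivity : 0 ≤ quadConst γ / μ ^ 2)
    have h2 : quadConst γ / μ ^ 2 * μ = quadConst γ / μ := by field_simp
    linarith
  rw [hs]
  unfold momentConst
  rw [add_div]
  linarith

end moments

/-! ### Linear rewards over decreasing probability vectors -/

section bestReply

variable {K : ℕ}

/-- `p` is an admissible strategy that maximises the linear reward `c`. -/
def IsBestReply (c p : Fin K → ℝ) : Prop :=
  p ∈ strategies K ∧ ∀ q ∈ strategies K, ∑ k, q k * c k ≤ ∑ k, p k * c k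

lemma strategies_mem_Icc {p : Fin K → ℝ} (hp : p ∈ strategies K) (k : Fin K) :
    p k ∈ Set.Icc (0 : ℝ) 1 :=
  ⟨hp.1.1 k, hp.1.2 ▸ Finset.single_le_sum (fun l _ => hp.1.1 l) (Finset.mem_univ k)⟩

/-- A deviation by `i` leaves her coefficients unchanged, since they involve only the opponents. -/
lemma mem_equilibria_iff {n : ℕ} {d : Fin K → ℝ} {s : ℕ → ℝ} {P : Fin n → Fin K → ℝ} :
    P ∈ equilibria n d s ↔ ∀ i, IsBestReply (typeValue d s P i) (P i) := by
  rw [equilibria, Set.mem_ofPred_eq, ← forall_and]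
  by_cases hP : ∀ i, P i ∈ strategies K
  · refine forall_congr' fun i => ?_
    refine and_congr_right fun _ => forall₂_congr fun q hq => ?_
    rw [utility_eq_sum_typeValue d s P i fun j _ => (hP j).1.2,
      utility_eq_sum_typeValue d s _ i fun j hj => by
        rw [Function.update_of_ne hj]; exact (hP j).1.2]
    have : typeValue d s (Function.update P i q) i = typeValue d s P i := by
      funext k
      unfold typeValue
      congr 1
      exact bernoulliExp_congr (fun j hj => by
        rw [Function.update_of_ne (Finset.ne_of_mem_erase hj)]) _
    simp [this]
  · constructor
    · intro h; exact (hP fun i => (h i).1).elim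
    · intro h; exact (hP fun i => (h i).1).elim

/-- The entry of `p` after the one at `k`, with the convention that it vanishes at the end. -/
def nextEntry (p : Fin K → ℝ) (k : Fin K) : ℝ :=
  if h : (k : ℕ) + 1 < K then p ⟨k + 1, h⟩ else 0

lemma nextEntry_nonneg {p : Fin K → ℝ} (hp : p ∈ strategies K) (k : Fin K) :
    0 ≤ nextEntry p k := by
  unfold nextEntry; split_ifs
  · exact hp.1.1 _
  · exact le_rfl

lemma nextEntry_le {p : Fin K → ℝ} (hp : p ∈ strategies K) (k : Fin K) :
    nextEntry p k ≤ p k := by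
  unfold nextEntry; split_ifs
  · exact hp.2 (Fin.le_def.2 (by simp))
  · exact hp.1.1 _

lemma le_nextEntry {p : Fin K → ℝ} (hp : p ∈ strategies K) {k l : Fin K} (h : k < l) :
    p l ≤ nextEntry p k := by
  have hk : (k : ℕ) + 1 < K := lt_of_le_of_lt (Fin.lt_def.1 h) l.2
  rw [nextEntry, dif_pos hk]
  exact hp.2 (Fin.le_def.2 (Fin.lt_def.1 h))

/-- The uniform distribution on the first types up to `k`. -/
noncomputable def uniformPrefix (k l : Fin K) : ℝ := if l ≤ k then 1 / ((k : ℝ) + 1) else 0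

lemma sum_uniformPrefix_mul (k : Fin K) (c : Fin K → ℝ) :
    ∑ l, uniformPrefix k l * c l = (∑ l ∈ Finset.Iic k, c l) / ((k : ℝ) + 1) := by
  simp only [uniformPrefix, ite_mul, zero_mul]
  rw [← Finset.sum_filter, Finset.sum_div]
  refine Finset.sum_congr (by ext; simp) fun l _ => by ring

lemma sum_uniformPrefix (k : Fin K) : ∑ l, uniformPrefix k l = 1 := by
  have := sum_uniformPrefix_mul k fun _ => 1
  simp only [mul_one, Finset.sum_const, Fin.card_Iic, nsmul_eq_mul, Nat.cast_add,
    Nat.cast_one] at this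
  rw [this, div_self (by positivity)]

lemma uniformPrefix_nonneg (k l : Fin K) : 0 ≤ uniformPrefix k l := by
  unfold uniformPrefix; split_ifs
  · positivity
  · exact le_rfl

lemma uniformPrefix_le_one (k l : Fin K) : uniformPrefix k l ≤ 1 := by
  unfold uniformPrefix; split_ifs
  · rw [div_le_one (by positivity)]
    linarith [Nat.cast_nonneg (α := ℝ) (k : ℕ)]
  · exact zero_le_one

lemma uniformPrefix_mem_strategies (k : Fin K) : uniformPrefix k ∈ strategies K := by
  refine ⟨⟨uniformPrefix_nonneg k, sum_uniformPrefix k⟩, fun a b hab => ?_⟩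
  by_cases hb : b ≤ k
  · simp [uniformPrefix, hb, hab.trans hb]
  · rw [uniformPrefix, if_neg hb]; exact uniformPrefix_nonneg k a

/-- Where a best reply drops strictly, the prefix ending there has maximal average reward. -/
lemma IsBestReply.prefix_average_le {c p : Fin K → ℝ} (h : IsBestReply c p) {m : Fin K}
    (hm : nextEntry p m < p m) (k : Fin K) :
    (∑ l ∈ Finset.Iic k, c l) / ((k : ℝ) + 1) ≤ (∑ l ∈ Finset.Iic m, c l) / ((m : ℝ) + 1) := by
  obtain ⟨hp, hbest⟩ := h
  -- Mass `ε` moves from the uniform prefix at `m` to that at `k`. The drop at `m` is just large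
  -- enough to keep the vector decreasing and nonnegative.
  set ε := p m - nextEntry p m with hε
  have hε0 : 0 < ε := sub_pos.2 hm
  have hv := uniformPrefix_mem_strategies k
  have hle : ∀ l, ε * uniformPrefix m l ≤ ε := fun l =>
    mul_le_of_le_one_right hε0.le (uniformPrefix_le_one m l)
  have hq : (fun l => p l + ε * (uniformPrefix k l - uniformPrefix m l)) ∈ strategies K := by
    refine ⟨⟨fun l => ?_, ?_⟩, fun a b hab => ?_⟩
    · have h1 := mul_nonneg hε0.le (uniformPrefix_nonneg k l)
      have h2 : ε * uniformPrefix m l ≤ p l := by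
        by_cases hl : l ≤ m
        · linarith [hle l, hp.2 hl, nextEntry_nonneg hp m]
        · rw [uniformPrefix, if_neg hl, mul_zero]; exact hp.1.1 l
      linarith
    · rw [Finset.sum_add_distrib, ← Finset.mul_sum, Finset.sum_sub_distrib, sum_uniformPrefix,
        sum_uniformPrefix, hp.1.2]
      ring
    · have h1 := mul_le_mul_of_nonneg_left (hv.2 hab) hε0.le
      have h2 : p b - ε * uniformPrefix m b ≤ p a - ε * uniformPrefix m a := by
        by_cases ha : a ≤ m
        · by_cases hb : b ≤ m
          · simp only [uniformPrefix, ha, hb, if_true]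
            linarith [hp.2 hab]
          · have e : uniformPrefix m b = 0 := if_neg hb
            rw [e]
            linarith [hle a, hp.2 ha, le_nextEntry hp (not_le.1 hb)]
        · have hb : ¬ b ≤ m := fun hb => ha (hab.trans hb)
          simp only [uniformPrefix, ha, hb, if_false]
          linarith [hp.2 hab]
      simp only
      linarith
  have hb := hbest _ hq
  have e : ∑ l, (p l + ε * (uniformPrefix k l - uniformPrefix m l)) * c l =
      ∑ l, p l * c l + ε * (∑ l, uniformPrefix k l * c l - ∑ l, uniformPrefix m l * c l) := by
    rw [← Finset.sum_sub_distrib, Finset.mul_sum, ← Finset.sum_add_distrib]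
    exact Finset.sum_congr rfl fun l _ => by ring
  rw [e, sum_uniformPrefix_mul, sum_uniformPrefix_mul] at hb
  by_contra! hlt
  have := mul_pos hε0 (sub_pos.2 hlt)
  linarith

/-- A drop at `m` would make its prefix optimal. But removing the worthless `m` raises a positive
average, and a zero average is beaten by any prefix reaching a positive reward. -/
lemma IsBestReply.eq_nextEntry {c p : Fin K → ℝ} (h : IsBestReply c p) (hc : ∀ k, 0 ≤ c k)
    (hpos : ∃ k, 0 < c k) {m : Fin K} (hm : c m = 0) : p m = nextEntry p m := by
  refine le_antisymm (not_lt.1 fun hlt => ?_) (nextEntry_le h.1 m)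
  have hswap := h.prefix_average_le hlt
  rcases (Finset.sum_nonneg fun l (_ : l ∈ Finset.Iic m) => hc l).eq_or_lt with h0 | h0
  · obtain ⟨k, hk⟩ := hpos
    have h1 := hswap k
    rw [← h0, zero_div] at h1
    have h2 : c k ≤ ∑ l ∈ Finset.Iic k, c l :=
      Finset.single_le_sum (fun l _ => hc l) (Finset.mem_Iic.2 le_rfl)
    have h3 : 0 < (∑ l ∈ Finset.Iic k, c l) / ((k : ℝ) + 1) :=
      div_pos (hk.trans_le h2) (by positivity)
    linarith
  · have hm0 : 0 < (m : ℕ) := by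
      by_contra hm0
      have : ∑ l ∈ Finset.Iic m, c l = 0 := by
        refine Finset.sum_eq_zero fun l hl => ?_
        have hl' := Fin.le_def.1 (Finset.mem_Iic.1 hl)
        have : l = m := Fin.ext (by omega)
        rw [this, hm]
      linarith
    have hmK := m.2
    have h1 := hswap ⟨m - 1, by omega⟩
    have hsum : ∑ l ∈ Finset.Iic (⟨m - 1, by omega⟩ : Fin K), c l =
        ∑ l ∈ Finset.Iic m, c l := by
      refine Finset.sum_subset (fun l hl => ?_) fun l hl hl' => ?_
      · simp only [Finset.mem_Iic, Fin.le_def] at hl ⊢; omega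
      · simp only [Finset.mem_Iic, Fin.le_def] at hl hl'
        have : l = m := Fin.ext (by omega)
        rw [this, hm]
    have hcast : (((m : ℕ) - 1 : ℕ) : ℝ) + 1 = (m : ℕ) := by
      rw [Nat.cast_sub hm0]; simp
    rw [hsum] at h1
    simp only [hcast] at h1
    have hm0' : (0 : ℝ) < (m : ℕ) := by exact_mod_cast hm0
    exact absurd h1 (not_le.2 (div_lt_div_of_pos_left h0 hm0' (by linarith)))

lemma isCompact_strategies : IsCompact (strategies K) := by
  refine (isCompact_stdSimplex ℝ (Fin K)).inter_right ?_
  have : {p : Fin K → ℝ | Antitone p} = ⋂ (a : Fin K) (b : Fin K) (_ : a ≤ b), {p | p b ≤ p a} := by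
    ext p; simp [Antitone]
  change IsClosed {p : Fin K → ℝ | Antitone p}
  rw [this]
  exact isClosed_iInter fun a => isClosed_iInter fun b => isClosed_iInter fun _ =>
    isClosed_le (continuous_apply b) (continuous_apply a)

lemma convex_strategies : Convex ℝ (strategies K) := by
  refine (convex_stdSimplex ℝ (Fin K)).inter fun p hp q hq a b ha hb _ => ?_
  intro x y hxy
  have h1 := mul_le_mul_of_nonneg_left (hp hxy) ha
  have h2 := mul_le_mul_of_nonneg_left (hq hxy) hb
  simpa using add_le_add h1 h2

/-- A separable continuous reward admits a fixed point of the best reply correspondence: the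
maximiser of its potential. -/
lemma exists_isBestReply [NeZero K] (G : Fin K → ℝ → ℝ) (hG : ∀ k, Continuous (G k)) :
    ∃ p : Fin K → ℝ, IsBestReply (fun k => G k (p k)) p := by
  have hderiv : ∀ k x, HasDerivAt (fun x => ∫ y in (0 : ℝ)..x, G k y) (G k x) x := fun k x =>
    intervalIntegral.integral_hasDerivAt_right ((hG k).intervalIntegrable _ _)
      ((hG k).stronglyMeasurableAtFilter _ _) (hG k).continuousAt
  have hcont : ∀ k, Continuous fun x => ∫ y in (0 : ℝ)..x, G k y := fun k =>
    continuous_iff_continuousAt.2 fun x => (hderiv k x).continuousAt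
  obtain ⟨p, hp, hmax⟩ := (isCompact_strategies (K := K)).exists_isMaxOn
    ⟨_, uniformPrefix_mem_strategies 0⟩
    (f := fun p : Fin K → ℝ => ∑ k, ∫ y in (0 : ℝ)..p k, G k y)
    (continuous_finsetSum _ fun k _ => (hcont k).comp (continuous_apply k)).continuousOn
  refine ⟨p, hp, fun q hq => ?_⟩
  -- At a maximiser the derivative towards any `q` is nonpositive, which is the best-reply
  -- inequality.
  have hline : HasDerivAt (fun t : ℝ => ∑ k, ∫ y in (0 : ℝ)..(p k + t * (q k - p k)), G k y)
      (∑ k, G k (p k) * (q k - p k)) 0 := by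
    refine HasDerivAt.fun_sum fun k _ => ?_
    have h1 : HasDerivAt (fun t : ℝ => p k + t * (q k - p k)) (q k - p k) 0 := by
      simpa using ((hasDerivAt_id (0 : ℝ)).mul_const (q k - p k)).const_add (p k)
    have h2 := hderiv k (p k + 0 * (q k - p k))
    have h3 := h2.comp (0 : ℝ) h1
    simpa [Function.comp_def] using h3
  have hmem : ∀ t ∈ Set.Icc (0 : ℝ) 1, (fun k => p k + t * (q k - p k)) ∈ strategies K := by
    intro t ht
    have := convex_strategies.add_smul_sub_mem hp hq ht
    exact this
  have hnonpos : ∑ k, G k (p k) * (q k - p k) ≤ 0 := by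
    have hlim := hline.hasDerivWithinAt (s := Set.Ioi 0)
    rw [hasDerivWithinAt_iff_tendsto_slope' Set.self_notMem_Ioi] at hlim
    refine le_of_tendsto hlim ?_
    filter_upwards [Ioo_mem_nhdsGT (zero_lt_one (α := ℝ))] with t ht
    have hle := hmax (hmem t ⟨ht.1.le, ht.2.le⟩)
    simp only [Set.mem_ofPred_eq] at hle
    rw [slope_def_field]
    refine div_nonpos_of_nonpos_of_nonneg ?_ (by linarith [ht.1])
    simp only [zero_mul, add_zero]
    linarith
  have e : ∑ k, G k (p k) * (q k - p k) = ∑ k, q k * G k (p k) - ∑ k, p k * G k (p k) := by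
    rw [← Finset.sum_sub_distrib]
    exact Finset.sum_congr rfl fun k _ => by ring
  linarith

/-! ### Existence and uniqueness of the symmetric equilibrium -/

section powerScore

variable {γ : ℝ}

lemma powerScore_strictMono (hγ : 0 < γ) : StrictMono (powerScore γ) := fun a b hab =>
  Real.rpow_lt_rpow (Nat.cast_nonneg a) (by exact_mod_cast hab) hγ

lemma powerScore_succ_pos (m : ℕ) : 0 < powerScore γ (m + 1) := by
  unfold powerScore; positivity

lemma strictAnti_one_div_powerScore (hγ : 0 < γ) :
    StrictAnti fun m => 1 / powerScore γ (m + 1) := fun a b hab =>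
  one_div_lt_one_div_of_lt (powerScore_succ_pos a) (powerScore_strictMono hγ (by omega))

end powerScore

section equilibria

variable {n : ℕ} {d : Fin K → ℝ} {γ : ℝ} {P : Fin n → Fin K → ℝ}

lemma bernoulliExp_powerScore_pos {S : Finset (Fin n)} {p : Fin n → ℝ}
    (hp : ∀ j ∈ S, p j ∈ Set.Icc (0 : ℝ) 1) :
    0 < bernoulliExp S p fun m => 1 / powerScore γ (m + 1) := by
  have := bernoulliExp_strictMono hp (φ := fun _ => 0)
    fun m => one_div_pos.2 (powerScore_succ_pos (γ := γ) m)
  rwa [bernoulliExp_const] at this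

lemma typeValue_nonneg (hd : ∀ k, 0 ≤ d k) (hP : ∀ j, P j ∈ strategies K) (i : Fin n)
    (k : Fin K) : 0 ≤ typeValue d (powerScore γ) P i k :=
  mul_nonneg (hd k) (bernoulliExp_powerScore_pos fun j _ => strategies_mem_Icc (hP j) k).le

lemma typeValue_pos {k : Fin K} (hd : 0 < d k) (hP : ∀ j, P j ∈ strategies K) (i : Fin n) :
    0 < typeValue d (powerScore γ) P i k :=
  mul_pos hd (bernoulliExp_powerScore_pos fun j _ => strategies_mem_Icc (hP j) k)

lemma eq_nextEntry_of_mem_equilibria (hd : ∀ k, 0 ≤ d k) (hd_ne : ∃ k, 0 < d k)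
    (hP : P ∈ equilibria n d (powerScore γ)) (i : Fin n) {m : Fin K} (hm : d m = 0) :
    P i m = nextEntry (P i) m := by
  obtain ⟨k, hk⟩ := hd_ne
  exact (mem_equilibria_iff.1 hP i).eq_nextEntry (typeValue_nonneg hd hP.1 i)
    ⟨k, typeValue_pos hk hP.1 i⟩ (by simp [typeValue, hm])

/-- Backward induction on the types: a property of the types of positive value that propagates
backwards through the types of value zero holds for all types. -/
lemma forall_of_pos_of_next {d : Fin K → ℝ} (hd : ∀ k, 0 ≤ d k) {Q : Fin K → Prop}
    (hpos : ∀ k, 0 < d k → Q k)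
    (hlast : ∀ k : Fin K, d k = 0 → ¬ (k : ℕ) + 1 < K → Q k)
    (hnext : ∀ (k : Fin K) (h : (k : ℕ) + 1 < K), d k = 0 → Q ⟨k + 1, h⟩ → Q k) (k : Fin K) :
    Q k := by
  rcases (hd k).eq_or_lt with h0 | h0
  · by_cases h : (k : ℕ) + 1 < K
    · exact hnext k h h0.symm (forall_of_pos_of_next hd hpos hlast hnext ⟨k + 1, h⟩)
    · exact hlast k h0.symm h
  · exact hpos k h0
termination_by K - (k : ℕ)

lemma bernoulliExp_erase_const (i j : Fin n) (x : ℝ) (φ : ℕ → ℝ) :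
    bernoulliExp (Finset.univ.erase i) (fun _ => x) φ =
      bernoulliExp (Finset.univ.erase j) (fun _ => x) φ := by
  simp [bernoulliExp, Finset.prod_const, Finset.card_erase_of_mem]

lemma exists_isSymmetricEquilibrium [NeZero K] (hn : 2 ≤ n) :
    ∃ p : Fin K → ℝ, IsSymmetricEquilibrium n d (powerScore γ) p := by
  let i₀ : Fin n := ⟨0, by omega⟩
  obtain ⟨p, hp⟩ := exists_isBestReply (fun k x => d k *
    bernoulliExp (Finset.univ.erase i₀) (fun _ => x) fun m => 1 / powerScore γ (m + 1))
    fun k => (continuous_bernoulliExp_param _ _).const_mul _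
  refine ⟨p, mem_equilibria_iff.2 fun i => ?_⟩
  convert hp using 1
  funext k
  rw [typeValue, bernoulliExp_erase_const i i₀]

/-- Adding the two best-reply inequalities makes a sum of nonnegative terms nonpositive. Strict
monotonicity then forces equality where `d k > 0`, and ties carry it to the other types. -/
lemma isSymmetricEquilibrium_unique (hn : 2 ≤ n) (hd : ∀ k, 0 ≤ d k) (hd_ne : ∃ k, 0 < d k)
    (hγ : 0 < γ) {p q : Fin K → ℝ} (hp : IsSymmetricEquilibrium n d (powerScore γ) p)
    (hq : IsSymmetricEquilibrium n d (powerScore γ) q) : p = q := by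
  let i : Fin n := ⟨0, by omega⟩
  -- Without an opponent `f` would be constant; this is where `2 ≤ n` enters.
  have hS : (Finset.univ.erase i).Nonempty :=
    ⟨⟨1, by omega⟩, Finset.mem_erase.2 ⟨by simp [i, Fin.ext_iff], Finset.mem_univ _⟩⟩
  set f : ℝ → ℝ := fun x =>
    bernoulliExp (Finset.univ.erase i) (fun _ => x) fun m => 1 / powerScore γ (m + 1) with hf
  have hanti : ∀ x ∈ Set.Icc (0 : ℝ) 1, ∀ y ∈ Set.Icc (0 : ℝ) 1, x < y → f y < f x :=
    fun x hx y hy hxy => bernoulliExp_strictAnti_param hS (fun _ _ => hx) (fun _ _ => hy)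
      (fun _ _ => hxy) (strictAnti_one_div_powerScore hγ)
  have hpi := mem_equilibria_iff.1 hp i
  have hqi := mem_equilibria_iff.1 hq i
  have h1 := hpi.2 q hqi.1
  have h2 := hqi.2 p hpi.1
  change ∑ k, q k * (d k * f (p k)) ≤ ∑ k, p k * (d k * f (p k)) at h1
  change ∑ k, p k * (d k * f (q k)) ≤ ∑ k, q k * (d k * f (q k)) at h2
  have hterm : ∀ k, 0 ≤ (q k - p k) * (f (p k) - f (q k)) := by
    intro k
    have hpk := strategies_mem_Icc hpi.1 k
    have hqk := strategies_mem_Icc hqi.1 k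
    rcases lt_trichotomy (p k) (q k) with h | h | h
    · exact mul_nonneg (by linarith) (by linarith [hanti _ hpk _ hqk h])
    · simp [h]
    · exact mul_nonneg_of_nonpos_of_nonpos (by linarith) (by linarith [hanti _ hqk _ hpk h])
  have hsum : ∑ k, d k * ((q k - p k) * (f (p k) - f (q k))) ≤ 0 := by
    have e : ∑ k, d k * ((q k - p k) * (f (p k) - f (q k))) =
        (∑ k, q k * (d k * f (p k)) - ∑ k, p k * (d k * f (p k))) +
        (∑ k, p k * (d k * f (q k)) - ∑ k, q k * (d k * f (q k))) := by
      rw [← Finset.sum_sub_distrib, ← Finset.sum_sub_distrib, ← Finset.sum_add_distrib]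
      exact Finset.sum_congr rfl fun k _ => by ring
    linarith
  have hzero := (Finset.sum_eq_zero_iff_of_nonneg
    fun k _ => mul_nonneg (hd k) (hterm k)).1
    (le_antisymm hsum (Finset.sum_nonneg fun k _ => mul_nonneg (hd k) (hterm k)))
  funext k
  refine forall_of_pos_of_next (Q := fun k => p k = q k) hd (fun k hk => ?_)
    (fun k hk hlast => ?_) (fun k h hk ih => ?_) k
  · have h0 := (mul_eq_zero.1 (hzero k (Finset.mem_univ k))).resolve_left hk.ne'
    have hpk := strategies_mem_Icc hpi.1 k
    have hqk := strategies_mem_Icc hqi.1 k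
    rcases lt_trichotomy (p k) (q k) with h | h | h
    · exact absurd h0 (mul_pos (by linarith) (by linarith [hanti _ hpk _ hqk h])).ne'
    · exact h
    · exact absurd h0 (mul_pos_of_neg_of_neg (by linarith) (by linarith [hanti _ hqk _ hpk h])).ne'
  · have a := eq_nextEntry_of_mem_equilibria hd hd_ne hp i hk
    have b := eq_nextEntry_of_mem_equilibria hd hd_ne hq i hk
    rw [nextEntry, dif_neg hlast] at a b
    exact a.trans b.symm
  · have a := eq_nextEntry_of_mem_equilibria hd hd_ne hp i hk
    have b := eq_nextEntry_of_mem_equilibria hd hd_ne hq i hk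
    rw [nextEntry, dif_pos h] at a b
    exact a.trans (Eq.trans ih b.symm)

end equilibria

end bestReply

/-! ### Average strategies and their linear lower bound -/

section convergence

variable {K n : ℕ} {d : Fin K → ℝ} {γ : ℝ} {P : Fin n → Fin K → ℝ}

lemma natCast_mul_averageStrategy (hn : 0 < n) (P : Fin n → Fin K → ℝ) (k : Fin K) :
    (n : ℝ) * averageStrategy P k = ∑ i, P i k := by
  have : (n : ℝ) ≠ 0 := by exact_mod_cast hn.ne'
  rw [averageStrategy, ← mul_assoc, mul_one_div_cancel this, one_mul]

lemma averageStrategy_const (hn : 0 < n) (p : Fin K → ℝ) :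
    averageStrategy (fun _ : Fin n => p) = p := by
  funext k
  have : (n : ℝ) ≠ 0 := by exact_mod_cast hn.ne'
  simp [averageStrategy, this]

lemma averageStrategy_mem (hn : 0 < n) (hP : ∀ i, P i ∈ strategies K) :
    averageStrategy P ∈ strategies K := by
  have hn' : (n : ℝ) ≠ 0 := by exact_mod_cast hn.ne'
  refine ⟨⟨fun k => ?_, ?_⟩, fun a b hab => ?_⟩
  · exact mul_nonneg (by positivity) (Finset.sum_nonneg fun i _ => (hP i).1.1 k)
  · simp only [averageStrategy]
    rw [← Finset.mul_sum, Finset.sum_comm, Finset.sum_congr rfl fun i _ => (hP i).1.2]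
    simp [hn']
  · exact mul_le_mul_of_nonneg_left (Finset.sum_le_sum fun i _ => (hP i).2 hab) (by positivity)

lemma shiftedMean_erase (hn : 0 < n) (P : Fin n → Fin K → ℝ) (i : Fin n) (k : Fin K) :
    shiftedMean (Finset.univ.erase i) (fun j => P j k) = n * averageStrategy P k + 1 - P i k := by
  rw [natCast_mul_averageStrategy hn, shiftedMean,
    ← Finset.add_sum_erase _ _ (Finset.mem_univ i)]
  ring

lemma le_shiftedMean_erase (hn : 0 < n) (hP : ∀ i, P i ∈ strategies K) (i : Fin n) (k : Fin K) :
    n * averageStrategy P k ≤ shiftedMean (Finset.univ.erase i) (fun j => P j k) := by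
  rw [shiftedMean_erase hn]
  linarith [(strategies_mem_Icc (hP i) k).2]

lemma shiftedMean_erase_le (hn : 0 < n) (hP : ∀ i, P i ∈ strategies K) (i : Fin n) (k : Fin K) :
    shiftedMean (Finset.univ.erase i) (fun j => P j k) ≤ n * averageStrategy P k + 1 := by
  rw [shiftedMean_erase hn]
  linarith [(strategies_mem_Icc (hP i) k).1]

lemma one_div_le_head [NeZero K] {p : Fin K → ℝ} (hp : p ∈ strategies K) :
    1 / (K : ℝ) ≤ p 0 := by
  have hK : (0 : ℝ) < K := by exact_mod_cast Nat.pos_of_ne_zero (NeZero.ne K)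
  rw [div_le_iff₀ hK, ← hp.1.2]
  calc ∑ k, p k ≤ ∑ _k : Fin K, p 0 := Finset.sum_le_sum fun k _ => hp.2 (Fin.zero_le k)
    _ = p 0 * K := by simp [mul_comm]

/-- If type `k` is played on average with probability below `1 / K`, some player's strategy drops
strictly at an earlier type that is played on average with probability at least `1 / K`. -/
lemma exists_drop [NeZero K] (hn : 0 < n) (hP : ∀ i, P i ∈ strategies K) {k : Fin K}
    (hk : averageStrategy P k < 1 / (K : ℝ)) :
    ∃ i m, nextEntry (P i) m < P i m ∧ 1 / (K : ℝ) ≤ averageStrategy P m := by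
  have havg := averageStrategy_mem hn hP
  have hne : (Finset.univ.filter fun l => 1 / (K : ℝ) ≤ averageStrategy P l).Nonempty :=
    ⟨0, by simpa using one_div_le_head havg⟩
  -- The last type with average at least `1 / K`: the average drops there, so some player's strategy
  -- does.
  obtain ⟨m, hm, hmax⟩ := Finset.exists_max_image _ (fun l : Fin K => l) hne
  replace hm := (Finset.mem_filter.1 hm).2
  have hmk : m < k := by
    by_contra h
    linarith [havg.2 (not_lt.1 h)]
  have hK : (m : ℕ) + 1 < K := lt_of_le_of_lt (Fin.lt_def.1 hmk) k.2
  have hnext : averageStrategy P ⟨m + 1, hK⟩ < 1 / (K : ℝ) := by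
    by_contra h
    have := Fin.le_def.1 (hmax ⟨m + 1, hK⟩ (Finset.mem_filter.2 ⟨Finset.mem_univ _, not_lt.1 h⟩))
    simp at this
  have hn' : (0 : ℝ) < n := by exact_mod_cast hn
  have hlt := mul_lt_mul_of_pos_left (hnext.trans_le hm) hn'
  rw [natCast_mul_averageStrategy hn, natCast_mul_averageStrategy hn] at hlt
  obtain ⟨i, -, hi⟩ := Finset.exists_lt_of_sum_lt hlt
  exact ⟨i, m, by rwa [nextEntry, dif_pos hK], hm⟩

lemma typeValue_le (hγ : 0 < γ) (hn : 0 < n) (hd : ∀ k, 0 ≤ d k) (hP : ∀ i, P i ∈ strategies K)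
    (i : Fin n) {l : Fin K} (hl : 1 / (K : ℝ) ≤ averageStrategy P l) :
    typeValue d (powerScore γ) P i l ≤
      d l * ((1 + momentConst γ) * ((K : ℝ) ^ γ * (n : ℝ) ^ (-γ))) := by
  refine mul_le_mul_of_nonneg_left ?_ (hd l)
  have hp : ∀ j ∈ Finset.univ.erase i, P j l ∈ Set.Icc (0 : ℝ) 1 :=
    fun j _ => strategies_mem_Icc (hP j) l
  refine (bernoulliExp_powerScore_le hγ hp).trans ?_
  have h1 := one_le_shiftedMean hp
  have h2 := le_shiftedMean_erase hn hP i l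
  have hn' : (0 : ℝ) < n := by exact_mod_cast hn
  have hK : (0 : ℝ) < K := by exact_mod_cast l.pos
  have h3 : (n : ℝ) / K ≤ shiftedMean (Finset.univ.erase i) (fun j => P j l) := by
    refine le_trans ?_ h2
    rw [div_eq_mul_one_div]
    exact mul_le_mul_of_nonneg_left hl hn'.le
  have hM := momentConst_nonneg hγ
  have h4 := Real.rpow_le_rpow_of_nonpos (div_pos hn' hK) h3 (neg_nonpos.2 hγ.le)
  rw [Real.div_rpow hn'.le hK.le, Real.rpow_neg hK.le, div_inv_eq_mul] at h4
  calc _ ≤ (n : ℝ) ^ (-γ) * (K : ℝ) ^ γ * (1 + momentConst γ) := by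
        refine mul_le_mul h4 ?_ (by positivity) (by positivity)
        have := div_le_self hM h1
        linarith
    _ = _ := by ring

/-- In equilibrium every type of positive value attracts linearly many players in expectation. -/
lemma exists_linear_lower_bound (hγ : 0 < γ) (hd : ∀ k, 0 ≤ d k) {k : Fin K} (hk : 0 < d k) :
    ∃ c : ℝ, 0 < c ∧ ∀ n : ℕ, 0 < n → ∀ P ∈ equilibria n d (powerScore γ),
      c * n ≤ n * averageStrategy P k + 1 := by
  have : NeZero K := ⟨k.pos.ne'⟩
  have hK : (0 : ℝ) < K := by exact_mod_cast k.pos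
  have hM := momentConst_nonneg hγ
  set D := ∑ l, d l with hD
  have hD0 : 0 < D := hk.trans_le (Finset.single_le_sum (fun l _ => hd l) (Finset.mem_univ k))
  set B := K * (D * ((1 + momentConst γ) * (K : ℝ) ^ γ)) / d k with hB
  have hB0 : 0 < B := by positivity
  -- If the average is below `1 / K`, comparing prefix `k` with the optimal prefix at a drop gives
  -- `x ^ (-γ) ≤ B * n ^ (-γ)` for `x = n * averageStrategy P k + 1`; the second entry solves this
  -- for `x`.
  refine ⟨min (1 / (K : ℝ)) (B ^ (-(1 / γ))), lt_min (by positivity) (by positivity),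
    fun n hn P hP => ?_⟩
  have hn' : (0 : ℝ) < n := by exact_mod_cast hn
  rcases le_or_gt (1 / (K : ℝ)) (averageStrategy P k) with h | h
  · have := mul_le_mul_of_nonneg_right ((min_le_left (1 / (K : ℝ)) (B ^ (-(1 / γ)))).trans h) hn'.le
    linarith
  obtain ⟨i, m, him, hm⟩ := exists_drop hn hP.1 h
  have havg := averageStrategy_mem hn hP.1
  have hnonneg := typeValue_nonneg (γ := γ) hd hP.1 i
  have hswap := (mem_equilibria_iff.1 hP i).prefix_average_le him k
  have hm1 : (1 : ℝ) ≤ (m : ℝ) + 1 := by linarith [Nat.cast_nonneg (α := ℝ) (m : ℕ)]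
  have hupper : (∑ l ∈ Finset.Iic m, typeValue d (powerScore γ) P i l) / ((m : ℝ) + 1) ≤
      D * ((1 + momentConst γ) * ((K : ℝ) ^ γ * (n : ℝ) ^ (-γ))) := by
    refine (div_le_self (Finset.sum_nonneg fun l _ => hnonneg l) hm1).trans ?_
    rw [hD, Finset.sum_mul]
    refine (Finset.sum_le_sum fun l hl => typeValue_le hγ hn hd hP.1 i
      (hm.trans (havg.2 (Finset.mem_Iic.1 hl)))).trans ?_
    exact Finset.sum_le_sum_of_subset_of_nonneg (Finset.subset_univ _)
      fun l _ _ => mul_nonneg (hd l) (by positivity)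
  set x := n * averageStrategy P k + 1 with hx
  have hx0 : 0 < x := by linarith [mul_nonneg hn'.le (havg.1.1 k)]
  have hp : ∀ j ∈ Finset.univ.erase i, P j k ∈ Set.Icc (0 : ℝ) 1 :=
    fun j _ => strategies_mem_Icc (hP.1 j) k
  have hlower : d k * x ^ (-γ) / K ≤
      (∑ l ∈ Finset.Iic k, typeValue d (powerScore γ) P i l) / ((k : ℝ) + 1) := by
    have h1 : d k * x ^ (-γ) ≤ ∑ l ∈ Finset.Iic k, typeValue d (powerScore γ) P i l := by
      refine le_trans ?_ (Finset.single_le_sum (fun l _ => hnonneg l)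
        (Finset.mem_Iic.2 (le_refl k)))
      refine mul_le_mul_of_nonneg_left ?_ hk.le
      refine le_trans ?_ (rpow_neg_shiftedMean_le hγ hp)
      exact Real.rpow_le_rpow_of_nonpos (by linarith [one_le_shiftedMean hp])
        (shiftedMean_erase_le hn hP.1 i k) (neg_nonpos.2 hγ.le)
    refine div_le_div₀ (Finset.sum_nonneg fun l _ => hnonneg l) h1 (by positivity) ?_
    exact_mod_cast k.2
  have hxB : x ^ (-γ) ≤ B * (n : ℝ) ^ (-γ) := by
    have h1 := (hlower.trans hswap).trans hupper
    rw [div_le_iff₀ hK, ← le_div_iff₀' hk] at h1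
    refine h1.trans (le_of_eq ?_)
    rw [hB]; ring
  have h2 := Real.rpow_le_rpow_of_nonpos (by positivity) hxB
    (by have := one_div_pos.2 hγ; linarith : -(1 / γ) ≤ 0)
  have hexp : -γ * -(1 / γ) = 1 := by field_simp
  rw [Real.mul_rpow hB0.le (by positivity), ← Real.rpow_mul hn'.le, ← Real.rpow_mul hx0.le,
    hexp, Real.rpow_one, Real.rpow_one] at h2
  exact (mul_le_mul_of_nonneg_right (min_le_right _ _) hn'.le).trans h2

lemma exists_uniform_linear_lower_bound (hγ : 0 < γ) (hd : ∀ k, 0 ≤ d k) (hd_ne : ∃ k, 0 < d k) :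
    ∃ c : ℝ, 0 < c ∧ ∀ k, 0 < d k → ∀ n : ℕ, 0 < n → ∀ P ∈ equilibria n d (powerScore γ),
      c * n ≤ n * averageStrategy P k + 1 := by
  have h : ∀ k : Fin K, ∃ c : ℝ, 0 < c ∧ (0 < d k → ∀ n : ℕ, 0 < n →
      ∀ P ∈ equilibria n d (powerScore γ), c * n ≤ n * averageStrategy P k + 1) := by
    intro k
    by_cases hk : 0 < d k
    · obtain ⟨c, hc, h⟩ := exists_linear_lower_bound (γ := γ) hγ hd hk
      exact ⟨c, hc, fun _ => h⟩
    · exact ⟨1, one_pos, fun h => (hk h).elim⟩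
  choose c hc h using h
  obtain ⟨k₀, -⟩ := hd_ne
  obtain ⟨m, -, hm⟩ := Finset.exists_min_image Finset.univ c ⟨k₀, Finset.mem_univ _⟩
  exact ⟨c m, hc m, fun k hk n hn P hP => (mul_le_mul_of_nonneg_right (hm k (Finset.mem_univ k))
    (Nat.cast_nonneg n)).trans (h k hk n hn P hP)⟩

/-! ### The approximate variational inequality -/

/-- The constant in the comparison of the scaled negative moment with the power of the mean. -/
noncomputable def scaleConst (γ c : ℝ) : ℝ := (γ + momentConst γ) * c ^ (-γ - 1)

/-- Omitting player `i` leaves `μ` between `n * a` and `n * a + 1`, where `a` is the average. This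
shift costs the `γ` in `scaleConst`, the moment bound costs `momentConst γ`. -/
lemma abs_scaled_bernoulliExp_sub_le (hγ : 0 < γ) (hn : 0 < n) (hP : ∀ i, P i ∈ strategies K)
    (i : Fin n) {k : Fin K} {c : ℝ} (hc : 0 < c) (hck : c ≤ averageStrategy P k) :
    |(n : ℝ) ^ γ * bernoulliExp (Finset.univ.erase i) (fun j => P j k)
        (fun m => 1 / powerScore γ (m + 1)) - averageStrategy P k ^ (-γ)| ≤
      scaleConst γ c / n := by
  have hp : ∀ j ∈ Finset.univ.erase i, P j k ∈ Set.Icc (0 : ℝ) 1 :=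
    fun j _ => strategies_mem_Icc (hP j) k
  have hlo := rpow_neg_shiftedMean_le hγ hp
  have hup := bernoulliExp_powerScore_le hγ hp
  have h1 := one_le_shiftedMean hp
  have h2 := le_shiftedMean_erase hn hP i k
  have h3 := shiftedMean_erase_le hn hP i k
  set μ := shiftedMean (Finset.univ.erase i) (fun j => P j k)
  set E := bernoulliExp (Finset.univ.erase i) (fun j => P j k)
    (fun m => 1 / powerScore γ (m + 1))
  set a := averageStrategy P k
  have hM := momentConst_nonneg hγ
  have hn' : (0 : ℝ) < n := by exact_mod_cast hn
  have ha : 0 < a := hc.trans_le hck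
  have hμ : 0 < μ := by linarith
  have hna : 0 < (n : ℝ) * a := mul_pos hn' ha
  have hnγ : 0 < (n : ℝ) ^ γ := Real.rpow_pos_of_pos hn' _
  have haγ : 0 < a ^ (-γ) := Real.rpow_pos_of_pos ha _
  have hpow : a ^ (-γ) / a ≤ c ^ (-γ - 1) := by
    rw [← Real.rpow_sub_one ha.ne']
    exact Real.rpow_le_rpow_of_nonpos hc hck (by linarith)
  have hscale : (n : ℝ) ^ γ * (n * a) ^ (-γ) = a ^ (-γ) := by
    rw [Real.mul_rpow hn'.le ha.le, ← mul_assoc, ← Real.rpow_add hn', add_neg_cancel,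
      Real.rpow_zero, one_mul]
  have hcn : 0 ≤ c ^ (-γ - 1) / n := by positivity
  have hup' : (n : ℝ) ^ γ * E ≤ a ^ (-γ) + momentConst γ * (c ^ (-γ - 1) / n) := by
    have e1 : μ ^ (-γ) ≤ (n * a) ^ (-γ) :=
      Real.rpow_le_rpow_of_nonpos hna h2 (neg_nonpos.2 hγ.le)
    have e2 : 1 + momentConst γ / μ ≤ 1 + momentConst γ / (n * a) := by
      have := div_le_div_of_nonneg_left hM hna h2
      linarith
    have e3 := mul_le_mul_of_nonneg_left
      (hup.trans (mul_le_mul e1 e2 (by positivity) (by positivity))) hnγ.le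
    rw [← mul_assoc, hscale] at e3
    refine e3.trans ?_
    have e4 := mul_le_mul_of_nonneg_left hpow (by positivity : 0 ≤ momentConst γ / n)
    have e5 : a ^ (-γ) * (1 + momentConst γ / (n * a)) =
      a ^ (-γ) + momentConst γ / n * (a ^ (-γ) / a) := by field_simp
    have e6 : momentConst γ / n * c ^ (-γ - 1) = momentConst γ * (c ^ (-γ - 1) / n) := by ring
    linarith
  have hlo' : a ^ (-γ) - γ * (c ^ (-γ - 1) / n) ≤ (n : ℝ) ^ γ * E := by
    have e1 : (n * a + 1) ^ (-γ) ≤ E :=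
      (Real.rpow_le_rpow_of_nonpos hμ h3 (neg_nonpos.2 hγ.le)).trans hlo
    have e2 := one_sub_mul_le_rpow_neg hγ.le (y := (n * a + 1) / (n * a)) (by positivity)
    have e3 : (n * a + 1) ^ (-γ) = (n * a) ^ (-γ) * ((n * a + 1) / (n * a)) ^ (-γ) := by
      rw [← Real.mul_rpow hna.le (by positivity), mul_div_cancel₀ _ hna.ne']
    have e4 : a ^ (-γ) * ((n * a + 1) / (n * a)) ^ (-γ) ≤ (n : ℝ) ^ γ * E := by
      rw [← hscale, mul_assoc, ← e3]
      exact mul_le_mul_of_nonneg_left e1 hnγ.le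
    refine le_trans ?_ ((mul_le_mul_of_nonneg_left e2 haγ.le).trans e4)
    have e5 : a ^ (-γ) * (1 - γ * ((n * a + 1) / (n * a) - 1)) =
      a ^ (-γ) - γ / n * (a ^ (-γ) / a) := by field_simp; ring
    have e6 := mul_le_mul_of_nonneg_left hpow (by positivity : 0 ≤ γ / n)
    have e7 : γ / n * c ^ (-γ - 1) = γ * (c ^ (-γ - 1) / n) := by ring
    linarith
  have e : scaleConst γ c / n = γ * (c ^ (-γ - 1) / n) + momentConst γ * (c ^ (-γ - 1) / n) := by
    unfold scaleConst; ring
  have := mul_nonneg hγ.le hcn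
  have := mul_nonneg hM hcn
  rw [e, abs_le]
  constructor <;> linarith

/-- The average strategy of an equilibrium approximately solves the variational inequality of the
limiting game with reward `d k * x ^ (-γ)`. -/
lemma average_variational_inequality (hγ : 0 < γ) (hn : 0 < n) (hd : ∀ k, 0 ≤ d k)
    (hP : P ∈ equilibria n d (powerScore γ)) {c : ℝ} (hc : 0 < c)
    (hck : ∀ k, 0 < d k → c ≤ averageStrategy P k) {q : Fin K → ℝ} (hq : q ∈ strategies K) :
    ∑ k, d k * ((q k - averageStrategy P k) * averageStrategy P k ^ (-γ)) ≤
      (∑ k, d k) * (scaleConst γ c / n) := by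
  have hn' : (0 : ℝ) < n := by exact_mod_cast hn
  have hnγ : 0 < (n : ℝ) ^ γ := Real.rpow_pos_of_pos hn' _
  have hi : ∀ i, ∑ k, d k * ((q k - P i k) * averageStrategy P k ^ (-γ)) ≤
      (∑ k, d k) * (scaleConst γ c / n) := by
    intro i
    have hbest := (mem_equilibria_iff.1 hP i).2 q hq
    have h1 : ∑ k, d k * ((q k - P i k) * ((n : ℝ) ^ γ * bernoulliExp (Finset.univ.erase i)
        (fun j => P j k) (fun m => 1 / powerScore γ (m + 1)))) ≤ 0 := by
      have e : ∑ k, d k * ((q k - P i k) * ((n : ℝ) ^ γ * bernoulliExp (Finset.univ.erase i)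
          (fun j => P j k) (fun m => 1 / powerScore γ (m + 1)))) =
          (n : ℝ) ^ γ * (∑ k, q k * typeValue d (powerScore γ) P i k -
            ∑ k, P i k * typeValue d (powerScore γ) P i k) := by
        rw [← Finset.sum_sub_distrib, Finset.mul_sum]
        refine Finset.sum_congr rfl fun k _ => ?_
        unfold typeValue; ring
      rw [e]
      exact mul_nonpos_of_nonneg_of_nonpos hnγ.le (by linarith)
    refine le_trans ?_ (add_le_of_nonpos_right h1)
    rw [Finset.sum_mul, ← Finset.sum_add_distrib]
    refine Finset.sum_le_sum fun k _ => ?_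
    rcases (hd k).eq_or_lt with h0 | h0
    · simp [← h0]
    rw [← mul_add]
    refine mul_le_mul_of_nonneg_left ?_ h0.le
    have h2 := abs_scaled_bernoulliExp_sub_le hγ hn hP.1 i hc (hck k h0)
    set E := (n : ℝ) ^ γ * bernoulliExp (Finset.univ.erase i)
        (fun j => P j k) (fun m => 1 / powerScore γ (m + 1))
    have h3 : |q k - P i k| ≤ 1 := by
      have a := strategies_mem_Icc hq k
      have b := strategies_mem_Icc (hP.1 i) k
      rw [abs_le]; constructor <;> linarith [a.1, a.2, b.1, b.2]
    have h4 : |(q k - P i k) * (E - averageStrategy P k ^ (-γ))| ≤ scaleConst γ c / n := by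
      rw [abs_mul]
      have := mul_le_mul h3 h2 (abs_nonneg _) zero_le_one
      linarith
    have h5 := neg_abs_le ((q k - P i k) * (E - averageStrategy P k ^ (-γ)))
    linarith
  -- The rewards no longer depend on `i`, so summation replaces each `P i` by the average.
  have hsum := Finset.sum_le_sum fun i (_ : i ∈ Finset.univ) => hi i
  rw [Finset.sum_comm, Finset.sum_const, Finset.card_univ, Fintype.card_fin, nsmul_eq_mul] at hsum
  have e : ∀ k, ∑ i, d k * ((q k - P i k) * averageStrategy P k ^ (-γ)) =
      n * (d k * ((q k - averageStrategy P k) * averageStrategy P k ^ (-γ))) := by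
    intro k
    rw [← Finset.mul_sum, ← Finset.sum_mul, Finset.sum_sub_distrib,
      ← natCast_mul_averageStrategy hn P, Finset.sum_const, Finset.card_univ, Fintype.card_fin,
      nsmul_eq_mul]
    ring
  rw [Finset.sum_congr rfl fun k _ => e k] at hsum
  rw [← Finset.mul_sum] at hsum
  exact le_of_mul_le_mul_left hsum hn'

/-! ### Strong monotonicity and the rate -/

/-- The slope of `-x ^ (-γ)` is at least `γ` on `(0, 1]`. -/
lemma mul_sq_le_sub_mul_rpow_neg_sub (hγ : 0 < γ) {x y : ℝ} (hx : 0 < x) (hx1 : x ≤ 1)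
    (hy : 0 < y) (hy1 : y ≤ 1) :
    γ * (x - y) ^ 2 ≤ (x - y) * (y ^ (-γ) - x ^ (-γ)) := by
  have key : ∀ {x y : ℝ}, 0 < x → x ≤ 1 → 0 < y → y ≤ x → γ * (x - y) ≤ y ^ (-γ) - x ^ (-γ) := by
    intro x y hx hx1 hy hyx
    have h1 := one_sub_mul_le_rpow_neg hγ.le (div_pos hy hx)
    have hxγ : 1 ≤ x ^ (-γ) := Real.one_le_rpow_of_pos_of_le_one_of_nonpos hx hx1 (by linarith)
    have h2 := mul_le_mul_of_nonneg_left h1 (zero_le_one.trans hxγ)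
    rw [← Real.mul_rpow hx.le (by positivity), mul_div_cancel₀ _ hx.ne'] at h2
    have h3 : x - y ≤ 1 - y / x := by
      rw [← div_self hx.ne', ← sub_div, le_div_iff₀ hx]
      exact mul_le_of_le_one_right (by linarith) hx1
    have h4 := mul_le_mul hxγ h3 (by linarith) (zero_le_one.trans hxγ)
    have h5 := mul_le_mul_of_nonneg_left h4 hγ.le
    linarith
  rcases le_total y x with h | h
  · have := mul_le_mul_of_nonneg_left (key hx hx1 hy h) (sub_nonneg.2 h)
    linarith
  · have := mul_le_mul_of_nonneg_left (key hy hy1 hx h) (sub_nonneg.2 h)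
    linarith

/-- The variational inequalities for `P` and for the symmetric profile are tested against each
other's average and added. -/
lemma sq_sub_averageStrategy_le (hγ : 0 < γ) (hn : 0 < n) (hd : ∀ k, 0 ≤ d k)
    (hP : P ∈ equilibria n d (powerScore γ)) {p : Fin K → ℝ}
    (hp : IsSymmetricEquilibrium n d (powerScore γ) p) {c : ℝ} (hc : 0 < c)
    (hcP : ∀ k, 0 < d k → c ≤ averageStrategy P k) (hcp : ∀ k, 0 < d k → c ≤ p k)
    {k : Fin K} (hk : 0 < d k) :
    d k * (γ * (p k - averageStrategy P k) ^ 2) ≤ 2 * ((∑ k, d k) * (scaleConst γ c / n)) := by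
  have havg := averageStrategy_mem hn hP.1
  have hpmem : p ∈ strategies K := hp.1 ⟨0, hn⟩
  have h1 := average_variational_inequality hγ hn hd hP hc hcP hpmem
  have h2 := average_variational_inequality hγ hn hd hp hc
    (by simpa [averageStrategy_const hn] using hcp) havg
  rw [averageStrategy_const hn] at h2
  have hterm : ∀ l, 0 < d l → γ * (p l - averageStrategy P l) ^ 2 ≤
      (p l - averageStrategy P l) * (averageStrategy P l ^ (-γ) - p l ^ (-γ)) := fun l hl =>
    mul_sq_le_sub_mul_rpow_neg_sub hγ (hc.trans_le (hcp l hl)) (strategies_mem_Icc hpmem l).2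
      (hc.trans_le (hcP l hl)) (strategies_mem_Icc havg l).2
  have hnonneg : ∀ l, 0 ≤ d l * ((p l - averageStrategy P l) *
      (averageStrategy P l ^ (-γ) - p l ^ (-γ))) := by
    intro l
    rcases (hd l).eq_or_lt with h0 | h0
    · simp [← h0]
    · exact mul_nonneg h0.le (le_trans (by positivity) (hterm l h0))
  have e : ∑ l, d l * ((p l - averageStrategy P l) *
      (averageStrategy P l ^ (-γ) - p l ^ (-γ))) =
      ∑ l, d l * ((p l - averageStrategy P l) * averageStrategy P l ^ (-γ)) +
      ∑ l, d l * ((averageStrategy P l - p l) * p l ^ (-γ)) := by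
    rw [← Finset.sum_add_distrib]
    exact Finset.sum_congr rfl fun l _ => by ring
  have h3 := Finset.single_le_sum (fun l _ => hnonneg l) (Finset.mem_univ k)
  have h4 := mul_le_mul_of_nonneg_left (hterm k hk) hk.le
  linarith

lemma averageStrategy_eq_nextEntry (hd : ∀ k, 0 ≤ d k) (hd_ne : ∃ k, 0 < d k)
    (hP : P ∈ equilibria n d (powerScore γ)) {m : Fin K} (hm : d m = 0) :
    averageStrategy P m = nextEntry (averageStrategy P) m := by
  have h : ∀ i, P i m = nextEntry (P i) m :=
    fun i => eq_nextEntry_of_mem_equilibria hd hd_ne hP i hm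
  unfold nextEntry at h ⊢
  split_ifs at h ⊢ with hK
  · simp [averageStrategy, h]
  · simp [averageStrategy, h]

lemma abs_sub_averageStrategy_le (hn : 0 < n) (hd : ∀ k, 0 ≤ d k) (hd_ne : ∃ k, 0 < d k)
    (hP : P ∈ equilibria n d (powerScore γ)) {p : Fin K → ℝ}
    (hp : IsSymmetricEquilibrium n d (powerScore γ) p) {B : ℝ} (hB : 0 ≤ B)
    (h : ∀ k, 0 < d k → |p k - averageStrategy P k| ≤ B) (k : Fin K) :
    |p k - averageStrategy P k| ≤ B := by
  refine forall_of_pos_of_next (Q := fun k => |p k - averageStrategy P k| ≤ B) hd h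
    (fun k hk hlast => ?_) (fun k hK hk ih => ?_) k
  · rw [averageStrategy_eq_nextEntry hd hd_ne hP hk,
      eq_nextEntry_of_mem_equilibria hd hd_ne hp ⟨0, hn⟩ hk, nextEntry, nextEntry,
      dif_neg hlast, dif_neg hlast]
    simpa using hB
  · rw [averageStrategy_eq_nextEntry hd hd_ne hP hk,
      eq_nextEntry_of_mem_equilibria hd hd_ne hp ⟨0, hn⟩ hk, nextEntry, nextEntry,
      dif_pos hK, dif_pos hK]
    exact ih

lemma exists_convergence_const (hγ : 0 < γ) (hd : ∀ k, 0 ≤ d k) (hd_ne : ∃ k, 0 < d k) :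
    ∃ C : ℝ, ∀ n : ℕ, 2 ≤ n → ∀ P ∈ equilibria n d (powerScore γ), ∀ p : Fin K → ℝ,
      IsSymmetricEquilibrium n d (powerScore γ) p → ∀ k,
        |p k - averageStrategy P k| ≤ C * Real.sqrt (Real.log n / n) := by
  obtain ⟨c, hc, hlow⟩ := exists_uniform_linear_lower_bound (γ := γ) hγ hd hd_ne
  have hM := momentConst_nonneg hγ
  have hS : 0 ≤ scaleConst γ (c / 2) := by unfold scaleConst; positivity
  set D := ∑ k, d k with hD
  have hD0 : 0 ≤ D := Finset.sum_nonneg fun k _ => hd k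
  have hpos : ∃ A : ℝ, 0 ≤ A ∧ ∀ n : ℕ, 2 ≤ n → ∀ P ∈ equilibria n d (powerScore γ),
      ∀ p : Fin K → ℝ, IsSymmetricEquilibrium n d (powerScore γ) p → ∀ k, 0 < d k →
        (p k - averageStrategy P k) ^ 2 ≤ A / n := by
    set T := ∑ k, 2 * (D * scaleConst γ (c / 2)) / (d k * γ) with hT
    have hT0 : ∀ k ∈ Finset.univ, 0 ≤ 2 * (D * scaleConst γ (c / 2)) / (d k * γ) := fun k _ =>
      div_nonneg (by positivity) (mul_nonneg (hd k) hγ.le)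
    refine ⟨2 / c + T, add_nonneg (by positivity) (Finset.sum_nonneg hT0),
      fun n hn P hP p hp k hk => ?_⟩
    have hn0 : 0 < n := by omega
    have hn' : (0 : ℝ) < n := by exact_mod_cast hn0
    have hpmem : p ∈ strategies K := hp.1 ⟨0, hn0⟩
    have havg := averageStrategy_mem hn0 hP.1
    -- For `n ≥ 2 / c` the `+ 1` in the lower bound is absorbed, leaving averages at least `c / 2`;
    -- for smaller `n` the trivial bound `1` is covered by the summand `2 / c`.
    rcases le_or_gt (2 / c) n with hcn | hcn
    · have hhalf : ∀ Q ∈ equilibria n d (powerScore γ), ∀ l, 0 < d l →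
          c / 2 ≤ averageStrategy Q l := by
        intro Q hQ l hl
        have h1 := hlow l hl n hn0 Q hQ
        rw [div_le_iff₀ hc] at hcn
        have h2 : n * (c / 2) ≤ n * averageStrategy Q l := by linarith
        exact le_of_mul_le_mul_left h2 hn'
      have h := sq_sub_averageStrategy_le hγ hn0 hd hP hp (half_pos hc) (hhalf P hP)
        (by simpa [averageStrategy_const hn0] using hhalf _ hp) hk
      have h1 := Finset.single_le_sum hT0 (Finset.mem_univ k)
      have hdk : 0 < d k * γ := mul_pos hk hγ
      rw [le_div_iff₀ hn']
      have h2 : (p k - averageStrategy P k) ^ 2 * n ≤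
          2 * (D * scaleConst γ (c / 2)) / (d k * γ) := by
        rw [le_div_iff₀ hdk]
        have h3 := mul_le_mul_of_nonneg_right h hn'.le
        have e : 2 * (D * (scaleConst γ (c / 2) / n)) * n = 2 * (D * scaleConst γ (c / 2)) := by
          field_simp
        linarith
      have : 0 < 2 / c := by positivity
      linarith
    · have a := strategies_mem_Icc hpmem k
      have b := strategies_mem_Icc havg k
      have h1 : (p k - averageStrategy P k) ^ 2 ≤ 1 := by
        rw [sq_le_one_iff_abs_le_one, abs_le]
        constructor <;> linarith [a.1, a.2, b.1, b.2]
      have h2 : 1 ≤ (2 / c + T) / n := by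
        rw [one_le_div hn']
        linarith [Finset.sum_nonneg hT0]
      exact h1.trans h2
  obtain ⟨A, hA, hpos⟩ := hpos
  have hlog2 : 0 < Real.log 2 := Real.log_pos one_lt_two
  -- The bound `A / n` is weakened by the factor `log n / log 2 ≥ 1`.
  refine ⟨Real.sqrt (A / Real.log 2), fun n hn P hP p hp => ?_⟩
  have hn0 : 0 < n := by omega
  have hn' : (0 : ℝ) < n := by exact_mod_cast hn0
  refine abs_sub_averageStrategy_le hn0 hd hd_ne hP hp (by positivity) fun k hk => ?_
  rw [← Real.sqrt_mul (by positivity)]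
  refine Real.abs_le_sqrt ((hpos n hn P hP p hp k hk).trans ?_)
  have hlog : Real.log 2 ≤ Real.log n := Real.log_le_log two_pos (by exact_mod_cast hn)
  rw [div_mul_div_comm, div_le_div_iff₀ hn' (by positivity)]
  have := mul_le_mul_of_nonneg_left hlog (mul_nonneg hA hn'.le)
  linarith

end convergence

end CompetitionGame

theorem mainTheorem9 (K : ℕ) (d : Fin K → ℝ) (hd : ∀ k, 0 ≤ d k) (hd_ne : ∃ k, 0 < d k)
    (γ : ℝ) (hγ : 0 < γ) :
    (∀ n : ℕ, 2 ≤ n →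
      ∃! p : Fin K → ℝ,
        CompetitionGame.IsSymmetricEquilibrium n d (CompetitionGame.powerScore γ) p) ∧
    ∃ C : ℝ, ∀ P : (n : ℕ) → Fin n → Fin K → ℝ,
      (∀ n : ℕ, 2 ≤ n → P n ∈ CompetitionGame.equilibria n d (CompetitionGame.powerScore γ)) →
      ∀ n : ℕ, 2 ≤ n → ∀ k : Fin K,
        |CompetitionGame.pEq n d (CompetitionGame.powerScore γ) k
            - CompetitionGame.averageStrategy (P n) k|
          ≤ C * Real.sqrt (Real.log n / n) := by
  have hK : NeZero K := ⟨hd_ne.choose.pos.ne'⟩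
  refine ⟨fun n hn => ?_, ?_⟩
  · obtain ⟨p, hp⟩ := CompetitionGame.exists_isSymmetricEquilibrium (d := d) (γ := γ) hn
    exact ⟨p, hp, fun q hq =>
      CompetitionGame.isSymmetricEquilibrium_unique hn hd hd_ne hγ hq hp⟩
  · obtain ⟨C, hC⟩ := CompetitionGame.exists_convergence_const hγ hd hd_ne
    refine ⟨C, fun P hP n hn => hC n hn (P n) (hP n hn) _ ?_⟩
    have hex := CompetitionGame.exists_isSymmetricEquilibrium (d := d) (γ := γ) hn
    -- Existence rules out the default value `0` of `pEq`.
    rw [CompetitionGame.pEq, dif_pos hex]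
    exact hex.choose_spec
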